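/- **Setting.** Let $\mathcal X,\mathcal Y$ be measurable spaces, let $\mu,\nu$ be probability distributions on $\mathcal X\times\mathcal Y$ (source and target) with $\mathcal X$-marginals $\mu_{\mathcal X},\nu_{\mathcal X}$, let $\ell:\mathcal Y\times\mathcal Y\to[0,1]$ be a measurable symmetric loss with $\ell(y_1,y_2)\le\ell(y_1,y_3)+\ell(y_3,y_2)$ for all $y_1,y_2,y_3$, and let $\mathcal H$ be a set of measurable functions $\mathcal X\to\mathcal Y$. For a distribution $\rho$ on $\mathcal X\times\mathcal Y$ put $R_\rho(h)=\mathbb E_{(X,Y)\sim\rho}\,\ell(h(X),Y)$; write $\ell(h,h')$ for the function $x\mapsto\ell(h(x),h'(x))$, with $\mathbb E_\mu$, $\mathrm{Var}_\mu$ of it taken under $\mu_{\mathcal X}$. For $s\in\mathbb R$ let $\mathcal H_s=\{h\in\mathcal H: R_\mu(h)\le s\}$ and $\mathcal H_s^\ell=\{\ell(h,h'):h,h'\in\mathcal H_s\}$. For distributions $P,Q$ on $\mathcal X$ define the localized $\chi^2$-domain discrepancy $$\mathrm D^{h,\mathcal H_r}_{\chi^2}(P\|Q)=\sup_{h'\in\mathcal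 H_r,\ t\ge 0}\Big\{\mathbb E_P[t\,\ell(h,h')]-\inf_{\alpha\in\mathbb R}\big(\mathbb E_Q[\phi^*(t\,\ell(h,h')+\alpha)]-\alpha\big)\Big\}\in[0,\infty],\qquad \phi^*(y)=\tfrac{y^2}{4}+y,$$ where $\phi^*$ is the convex conjugate of $\phi(x)=(x-1)^2$, $x\in\mathbb R$. Let $R^r_\mu(h)=\sup_{h'\in\mathcal H_r}\mathbb E_\mu\,\ell(h,h')$ and $\lambda_r^*=\inf_{h'\in\mathcal H_r}\big(R_\mu(h')+R_\nu(h')\big)$. For a sample $x=(x_1,\dots,x_n)$ and a class $\mathcal F$ of real functions let $\hat{\mathfrak R}_x(\mathcal F)=\mathbb E_\varepsilon\sup_{f\in\mathcal F}\frac1n\sum_{i}\varepsilon_i f(x_i)$ with independent uniform signs $\varepsilon_i$. Let $\mathcal S=((X_i,Y_i))_{i=1}^n$ be i.i.d. from $\mu$ and $\mathcal T=(X'_j)_{j=1}^m$ be i.i.d. from $\nu_{\mathcal X}$ ($n,m\ge1$), with empirical distributions $\hat\mu$ and $\hat\nu$; $R_{\hat\mu}(h)=\frac1n\sum_i\ell(h(X_i),Y_i)$,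 and $\hat{\mathfrak R}_{\mathcal S}$, $\hat{\mathfrak R}_{\mathcal T}$ are evaluated at the inputs $X_1,\dots,X_n$ and $X'_1,\dots,X'_m$. **Theorem.** For every $C_1>0$ there is a constant $K$, depending on $C_1$ only, such that the following holds in every such setting. Let $r,r_1\in\mathbb R$ with $\mathcal H_r\neq\emptyset$, let $h\in\mathcal H_{r_1}$, and let $C_2\in(0,1)$ satisfy $$\frac{C_1\,\mathrm{Var}_\mu(\ell(h,h'))}{4}\le C_2\,\mathbb E_\mu\,\ell(h,h')\qquad\text{for all }h'\in\mathcal H_r.$$ Then for every $\delta\in(0,1)$, with probability at least $1-\delta$, $$\begin{aligned}R_\nu(h)\le{}& R_{\hat\mu}(h)+\frac{\mathrm D^{h,\mathcal H_r}_{\chi^2}(\hat\nu\|\hat\mu)}{C_1}+C_2R^r_\mu(h)+\lambda_r^*+K\Big(\hat{\mathfrak R}_{\mathcal T}(\mathcal H^\ell_r)+\hat{\mathfrak R}_{\mathcal S}(\mathcal H^\ell_{\max\{r,r_1\}})\Big)\\&+K\Big(\frac{\log(1/\delta)}{n}+\frac{\log(1/\delta)}{m}\Big)+K\Big(\sqrt{\frac{(r_1+r)\log(1/\delta)}{n}}+\sqrt{\frac{(r_1+r)\log(1/\delta)}{m}}\Big).\end{aligned}$$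 -/

import Mathlib

open MeasureTheory ProbabilityTheory
open scoped ENNReal

universe u v w

noncomputable section

namespace DomainAdaptation

/-- Convex conjugate `φ^*(y) = sup_x (x y - φ x)` of a real function on the line. -/
def convexConj (φ : ℝ → ℝ) (y : ℝ) : ℝ := ⨆ x : ℝ, (x * y - φ x)

/-- The generator of the `χ²`-divergence. -/
def chiSq (x : ℝ) : ℝ := (x - 1) ^ 2

/-- The conjugate of the `χ²` generator is `y ^ 2 / 4 + y`. -/
theorem convexConj_chiSq (y : ℝ) : convexConj chiSq y = y ^ 2 / 4 + y := by
  unfold convexConj chiSq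
  have hle : ∀ x : ℝ, x * y - (x - 1) ^ 2 ≤ y ^ 2 / 4 + y := fun x => by
    nlinarith [sq_nonneg (x - 1 - y / 2)]
  refine le_antisymm (ciSup_le hle) ?_
  have h := le_ciSup (f := fun x : ℝ => x * y - (x - 1) ^ 2) ⟨_, by rintro _ ⟨x, rfl⟩; exact hle x⟩
    (1 + y / 2)
  refine le_trans (le_of_eq ?_) h
  ring

/-- Empirical distribution `(1/n) ∑ i, δ_{x i}` of a finite sample. -/
def empirical {α : Type*} [MeasurableSpace α] {n : ℕ} (x : Fin n → α) : Measure α :=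
  (n : ℝ≥0∞)⁻¹ • ∑ i, Measure.dirac (x i)

variable {𝒳 𝒴 : Type*} [MeasurableSpace 𝒳] [MeasurableSpace 𝒴]

/-- The risk `R_ρ(h) = E_{(X,Y) ~ ρ} ℓ(h(X), Y)`. -/
def risk (ℓ : 𝒴 → 𝒴 → ℝ) (ρ : Measure (𝒳 × 𝒴)) (h : 𝒳 → 𝒴) : ℝ :=
  ∫ z, ℓ (h z.1) z.2 ∂ρ

/-- The Rashomon set `H_r = {h ∈ H | R_μ(h) ≤ r}`. -/
def rashomon (ℓ : 𝒴 → 𝒴 → ℝ) (μ : Measure (𝒳 × 𝒴)) (H : Set (𝒳 → 𝒴)) (r : ℝ) :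
    Set (𝒳 → 𝒴) :=
  {h ∈ H | risk ℓ μ h ≤ r}

/-- The disagreement `ℓ(h, h')`, as a function of the input. -/
def disagree (ℓ : 𝒴 → 𝒴 → ℝ) (h h' : 𝒳 → 𝒴) (x : 𝒳) : ℝ := ℓ (h x) (h' x)

/-- The class `H^ℓ = {x ↦ ℓ(h(x), h'(x)) | h, h' ∈ H}`. -/
def lossClass (ℓ : 𝒴 → 𝒴 → ℝ) (H : Set (𝒳 → 𝒴)) : Set (𝒳 → ℝ) :=
  {f | ∃ h ∈ H, ∃ h' ∈ H, f = disagree ℓ h h'}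

/-- `I_{φ,Q}(g) = inf_α { E_Q[φ^*(g + α)] - α }`. -/
def shiftInf (φ : ℝ → ℝ) (Q : Measure 𝒳) (g : 𝒳 → ℝ) : ℝ :=
  ⨅ α : ℝ, (∫ x, convexConj φ (g x + α) ∂Q) - α

/-- The localized `f`-domain discrepancy
`D_φ^{h,H}(P‖Q) = sup_{h' ∈ H, t ≥ 0} E_P[t ℓ(h,h')] - I_{φ,Q}(t ℓ(h,h'))`;
the supremum may be infinite. -/
def localDD (φ : ℝ → ℝ) (ℓ : 𝒴 → 𝒴 → ℝ) (H : Set (𝒳 → 𝒴)) (h : 𝒳 → 𝒴) (P Q : Measure 𝒳) :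
    EReal :=
  ⨆ h' ∈ H, ⨆ t ∈ Set.Ici (0 : ℝ),
    (((∫ x, t * disagree ℓ h h' x ∂P) -
      shiftInf φ Q (fun x => t * disagree ℓ h h' x) : ℝ) : EReal)

/-- `sup_{h' ∈ H} E_Q[ℓ(h,h')]`. -/
def supDisagree (ℓ : 𝒴 → 𝒴 → ℝ) (H : Set (𝒳 → 𝒴)) (h : 𝒳 → 𝒴) (Q : Measure 𝒳) : ℝ :=
  ⨆ h' : H, ∫ x, disagree ℓ h h' x ∂Q

/-- The ideal joint risk `inf_{h ∈ H} (R_μ(h) + R_ν(h))`. -/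
def jointRisk (ℓ : 𝒴 → 𝒴 → ℝ) (H : Set (𝒳 → 𝒴)) (μ ν : Measure (𝒳 × 𝒴)) : ℝ :=
  ⨅ h : H, (risk ℓ μ h + risk ℓ ν h)

/-- Empirical Rademacher complexity `E_ε sup_{f ∈ F} (1/n) ∑ i, ε_i f(x_i)`, where `ε` is uniform
on the `2 ^ n` sign vectors. -/
def rademacher {α : Type*} {n : ℕ} (x : Fin n → α) (F : Set (α → ℝ)) : ℝ :=
  ((2 : ℝ) ^ n)⁻¹ * ∑ ε : Fin n → ℤˣ,
    ⨆ f : F, (1 / (n : ℝ)) * ∑ i, ((ε i : ℤ) : ℝ) * (f : α → ℝ) (x i)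

end DomainAdaptation

end

/-!
For every `h' ∈ H_r` the triangle inequality gives `R_ν(h) ≤ E_ν ℓ(h,h') + R_ν(h')`, so it
suffices to bound `E_ν ℓ(h,h')` for one `h'` nearly attaining `λ_r^*`. Minimising over the shift `α`
turns the discrepancy into `sup_{h',t} t (E_ν̂ - E_μ̂) ℓ(h,h') - t² Var_μ̂(ℓ(h,h')) / 4`, and
`t = C₁` replaces the target mean by the source mean at the price of `C₁ Var_μ̂ / 4`. As `h'` is
fixed, Bernstein's inequality applies to single functions; their variances are of order `r + r₁`,
because `E_μ ℓ(h,h') ≤ R_μ(h) + R_μ(h')`, unless `E_ν ℓ(h,h')` exceeds `4 (1 + C₁) (r + r₁)`. In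
that case `t = 4 C₁` makes the discrepancy alone dominate `E_ν ℓ(h,h')` up to a multiple of
`log(1/δ) (1/n + 1/m)`. The Rademacher complexities enter only through being nonnegative.
-/

namespace DomainAdaptation

section Concentration

variable {α β Ω : Type*} [MeasurableSpace α] [MeasurableSpace β] [MeasurableSpace Ω]
  {P : Measure Ω}

theorem mgf_le_exp_of_mem_Icc [IsProbabilityMeasure P] {X : Ω → ℝ} (hX : AEMeasurable X P)
    {B : ℝ} (hB : ∀ᵐ ω ∂P, X ω ∈ Set.Icc 0 B) {t : ℝ} (ht : |t| * B ≤ 1) :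
    mgf X P t ≤ Real.exp ((t + t ^ 2 * B) * P[X]) := by
  have hlin : Integrable (fun ω => (t + t ^ 2 * B) * X ω) P :=
    (Integrable.of_mem_Icc 0 B hX hB).const_mul _
  have hpt : ∀ᵐ ω ∂P, Real.exp (t * X ω) ≤ (t + t ^ 2 * B) * X ω + 1 := by
    filter_upwards [hB] with ω ⟨h0, hle⟩
    have htX : |t * X ω| ≤ 1 := by
      rw [abs_mul, abs_of_nonneg h0]
      exact (mul_le_mul_of_nonneg_left hle (abs_nonneg t)).trans ht
    have hexp := (abs_le.1 (Real.abs_exp_sub_one_sub_id_le htX)).2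
    have hsq : t ^ 2 * (X ω * X ω) ≤ t ^ 2 * (B * X ω) := by gcongr
    linarith
  calc mgf X P t ≤ ∫ ω, ((t + t ^ 2 * B) * X ω + 1) ∂P :=
        integral_mono_ae (integrable_exp_mul_of_mem_Icc hX hB)
          (hlin.add (integrable_const 1)) hpt
    _ = (t + t ^ 2 * B) * P[X] + 1 := by
        rw [integral_add hlin (integrable_const 1), integral_const_mul, integral_const,
          probReal_univ, one_smul]
    _ ≤ Real.exp ((t + t ^ 2 * B) * P[X]) := Real.add_one_le_exp _

theorem mgf_add_le {X Y : Ω → ℝ} {t : ℝ}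
    (hX : Integrable (fun ω => Real.exp (2 * t * X ω)) P)
    (hY : Integrable (fun ω => Real.exp (2 * t * Y ω)) P) :
    mgf (X + Y) P t ≤ (mgf X P (2 * t) + mgf Y P (2 * t)) / 2 := by
  have hpt : ∀ ω, Real.exp (t * (X + Y) ω) ≤
      (Real.exp (2 * t * X ω) + Real.exp (2 * t * Y ω)) / 2 := fun ω => by
    have hmul : ∀ x : ℝ, Real.exp (2 * t * x) = Real.exp (t * x) ^ 2 := fun x => by
      rw [← Real.exp_nat_mul, Nat.cast_ofNat, mul_assoc]
    rw [hmul, hmul, Pi.add_apply, mul_add, Real.exp_add]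
    linarith [two_mul_le_add_sq (Real.exp (t * X ω)) (Real.exp (t * Y ω))]
  calc mgf (X + Y) P t
      ≤ ∫ ω, (Real.exp (2 * t * X ω) + Real.exp (2 * t * Y ω)) / 2 ∂P :=
        integral_mono_of_nonneg (.of_forall fun _ => (Real.exp_pos _).le)
          ((hX.add hY).div_const 2) (.of_forall hpt)
    _ = (mgf X P (2 * t) + mgf Y P (2 * t)) / 2 := by
        rw [integral_div, integral_add hX hY, mgf, mgf]

theorem measure_ge_le_exp_neg_of_mgf_le [IsFiniteMeasure P] {X : Ω → ℝ} {b v L : ℝ} (hb : 0 < b)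
    (hv : 0 ≤ v) (hL : 0 < L) (hX : ∀ t, 0 ≤ t → Integrable (fun ω => Real.exp (t * X ω)) P)
    (hmgf : ∀ t, 0 < t → t * b ≤ 1 → mgf X P t ≤ Real.exp (t ^ 2 * v)) :
    P.real {ω | b * L + 2 * √(v * L) ≤ X ω} ≤ Real.exp (-L) := by
  set s := √(v / L)
  have hs : 0 ≤ s := Real.sqrt_nonneg _
  have hvs : v = s ^ 2 * L := by rw [Real.sq_sqrt (by positivity), div_mul_cancel₀ _ hL.ne']
  have hsL : √(v * L) = s * L := by
    rw [hvs, mul_assoc, ← sq, ← mul_pow, Real.sqrt_sq (by positivity)]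
  have hbs : 0 < b + s := by positivity
  have hexponent : -(b + s)⁻¹ * (b * L + 2 * (s * L)) + (b + s)⁻¹ ^ 2 * (s ^ 2 * L) ≤ -L := by
    have hrw : -(b + s)⁻¹ * (b * L + 2 * (s * L)) + (b + s)⁻¹ ^ 2 * (s ^ 2 * L) =
        -L - L * (b * s) / (b + s) ^ 2 := by
      field_simp
      ring
    rw [hrw]
    exact sub_le_self _ (by positivity)
  calc P.real {ω | b * L + 2 * √(v * L) ≤ X ω}
      ≤ Real.exp (-(b + s)⁻¹ * (b * L + 2 * √(v * L))) * mgf X P (b + s)⁻¹ :=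
        measure_ge_le_exp_mul_mgf _ (inv_pos.2 hbs).le (hX _ (inv_pos.2 hbs).le)
    _ ≤ Real.exp (-(b + s)⁻¹ * (b * L + 2 * √(v * L))) * Real.exp ((b + s)⁻¹ ^ 2 * v) := by
        gcongr
        exact hmgf _ (inv_pos.2 hbs) ((inv_mul_le_one₀ hbs).2 (le_add_of_nonneg_right hs))
    _ ≤ Real.exp (-L) := by
        rw [← Real.exp_add, Real.exp_le_exp, hsL, hvs]
        exact hexponent

theorem integral_empirical {n : ℕ} (x : Fin n → α) {f : α → ℝ} (hf : StronglyMeasurable f) :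
    ∫ z, f z ∂empirical x = (n : ℝ)⁻¹ * ∑ i, f (x i) := by
  rw [empirical, integral_smul_measure,
    integral_finsetSum_measure fun i _ => integrable_dirac' hf (by finiteness)]
  simp [integral_dirac' f _ hf]

instance isProbabilityMeasure_empirical {n : ℕ} [NeZero n] (x : Fin n → α) :
    IsProbabilityMeasure (empirical x) :=
  ⟨by simp [empirical, ENNReal.inv_mul_cancel, NeZero.ne n]⟩

theorem map_empirical {n : ℕ} (x : Fin n → α) {f : α → β} (hf : Measurable f) :
    (empirical x).map f = empirical fun i => f (x i) := by
  simp only [empirical, Measure.map_smul, Measure.map_finset_sum' hf.aemeasurable,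
    Measure.map_dirac' hf]

theorem integral_mem_Icc {ρ : Measure α} [IsProbabilityMeasure ρ] {f : α → ℝ} (hf : Measurable f)
    {a b : ℝ} (hab : ∀ x, f x ∈ Set.Icc a b) : ∫ x, f x ∂ρ ∈ Set.Icc a b :=
  (convex_Icc a b).integral_mem isClosed_Icc (.of_forall hab)
    (.of_mem_Icc a b hf.aemeasurable (.of_forall hab))

/-- The deviation of the empirical mean of `G` over the sample `x` from its mean under `ρ`. -/
noncomputable def deviation {n : ℕ} (ρ : Measure α) (G : α → ℝ) (x : Fin n → α) : ℝ :=
  ∫ z, G z ∂empirical x - ∫ z, G z ∂ρ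

theorem aemeasurable_deviation {ρ : Measure α} {n : ℕ} {S : Fin n → Ω → α}
    (hS : ∀ i, AEMeasurable (S i) P) {G : α → ℝ} (hG : Measurable G) :
    AEMeasurable (fun ω => deviation ρ G fun i => S i ω) P := by
  simp only [deviation, integral_empirical _ hG.stronglyMeasurable]
  exact ((Finset.aemeasurable_fun_sum _ fun i _ => hG.comp_aemeasurable (hS i)).const_mul
    _).sub_const _

theorem deviation_mem_Icc {ρ : Measure α} [IsProbabilityMeasure ρ] {n : ℕ} [NeZero n]
    {G : α → ℝ} (hG : Measurable G) {B : ℝ} (hB : ∀ x, G x ∈ Set.Icc 0 B) (x : Fin n → α) :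
    deviation ρ G x ∈ Set.Icc (-B) B := by
  have hemp := integral_mem_Icc (ρ := empirical x) hG hB
  have htrue := integral_mem_Icc (ρ := ρ) hG hB
  rw [deviation]
  constructor <;> linarith [hemp.1, hemp.2, htrue.1, htrue.2]

theorem mgf_deviation_le [IsProbabilityMeasure P] {ρ : Measure α} {n : ℕ} [NeZero n]
    {S : Fin n → Ω → α} (hS : iIndepFun S P) (hlaw : ∀ i, HasLaw (S i) ρ P)
    {G : α → ℝ} (hG : Measurable G) {B : ℝ} (hB : ∀ x, G x ∈ Set.Icc 0 B)
    {t : ℝ} (ht : |t| * B ≤ n) :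
    mgf (fun ω => deviation ρ G fun i => S i ω) P t ≤
      Real.exp (t ^ 2 * (B * (∫ x, G x ∂ρ) / n)) := by
  have hn : (0 : ℝ) < n := Nat.cast_pos.2 (NeZero.pos n)
  set g := ∫ x, G x ∂ρ
  have hterm : ∀ i, mgf (G ∘ S i) P (t * (n : ℝ)⁻¹) ≤
      Real.exp ((t * (n : ℝ)⁻¹ + (t * (n : ℝ)⁻¹) ^ 2 * B) * g) := fun i => by
    have hmean : P[G ∘ S i] = g := (hlaw i).integral_comp hG.aestronglyMeasurable
    rw [← hmean]
    refine mgf_le_exp_of_mem_Icc (hG.comp_aemeasurable (hlaw i).aemeasurable)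
      (.of_forall fun ω => hB (S i ω)) ?_
    rwa [abs_mul, abs_inv, Nat.abs_cast, mul_right_comm, ← div_eq_mul_inv, div_le_one hn]
  have hsum : (fun ω => deviation ρ G fun i => S i ω) =
      fun ω => (n : ℝ)⁻¹ * (∑ i, G ∘ S i) ω + -g := by
    funext ω
    rw [deviation, integral_empirical _ hG.stronglyMeasurable, Finset.sum_apply, sub_eq_add_neg]
    rfl
  rw [hsum, mgf_add_const, mgf_const_mul, mul_comm _ t,
    (hS.comp (fun _ => G) fun _ => hG).mgf_sum₀
      fun i => hG.comp_aemeasurable (hlaw i).aemeasurable]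
  calc (∏ i, mgf (G ∘ S i) P (t * (n : ℝ)⁻¹)) * Real.exp (t * -g)
      ≤ (∏ _i : Fin n, Real.exp ((t * (n : ℝ)⁻¹ + (t * (n : ℝ)⁻¹) ^ 2 * B) * g)) *
          Real.exp (t * -g) := by
        gcongr with i
        · exact fun _ _ => mgf_nonneg
        · exact hterm i
    _ = Real.exp (t ^ 2 * (B * g / n)) := by
        rw [Finset.prod_const, Finset.card_fin, ← Real.exp_nat_mul, ← Real.exp_add]
        congr 1
        field_simp
        ring

theorem sqrt_add_le_add_sqrt {a b : ℝ} (ha : 0 ≤ a) (hb : 0 ≤ b) : √(a + b) ≤ √a + √b :=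
  Real.sqrt_le_iff.2 ⟨by positivity, by
    rw [add_sq, Real.sq_sqrt ha, Real.sq_sqrt hb]
    linarith [mul_nonneg (Real.sqrt_nonneg a) (Real.sqrt_nonneg b)]⟩

section TwoSamples

variable [IsProbabilityMeasure P] {μ : Measure α} {ν : Measure β}
  [IsProbabilityMeasure μ] [IsProbabilityMeasure ν] {n m : ℕ} [NeZero n] [NeZero m]
  {S : Fin n → Ω → α} (hS : iIndepFun S P) (hSμ : ∀ i, HasLaw (S i) μ P)
  {T : Fin m → Ω → β} (hT : iIndepFun T P) (hTν : ∀ j, HasLaw (T j) ν P)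
  {G : α → ℝ} (hG : Measurable G) {F : β → ℝ} (hF : Measurable F)
include hS hSμ hT hTν hG hF

/- The two samples may be dependent, so the deviations are decoupled inside the moment generating
function; a union bound would cost `log (2 / δ)`, which is not `O(log (1 / δ))` as `δ → 1`. -/
theorem mgf_deviation_sub_deviation_le {A B : ℝ} (hGB : ∀ x, G x ∈ Set.Icc 0 B)
    (hFA : ∀ y, F y ∈ Set.Icc 0 A) {t : ℝ} (ht : 0 ≤ t) (htB : 2 * t * B ≤ n)
    (htA : 2 * t * A ≤ m) :
    mgf (fun ω => deviation μ G (fun i => S i ω) - deviation ν F fun j => T j ω) P t ≤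
      Real.exp (t ^ 2 * (4 * (B * (∫ x, G x ∂μ) / n + A * (∫ y, F y ∂ν) / m))) := by
  set U : Ω → ℝ := fun ω => deviation μ G fun i => S i ω
  set V : Ω → ℝ := fun ω => deviation ν F fun j => T j ω
  set u := B * (∫ x, G x ∂μ) / n
  set v := A * (∫ y, F y ∂ν) / m
  have hμG := integral_mem_Icc (ρ := μ) hG hGB
  have hνF := integral_mem_Icc (ρ := ν) hF hFA
  have hu : 0 ≤ u := div_nonneg (mul_nonneg (hμG.1.trans hμG.2) hμG.1) n.cast_nonneg
  have hv : 0 ≤ v := div_nonneg (mul_nonneg (hνF.1.trans hνF.2) hνF.1) m.cast_nonneg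
  have h2t : 0 ≤ 2 * t := by positivity
  have hU : Integrable (fun ω => Real.exp (2 * t * U ω)) P :=
    integrable_exp_mul_of_le _ B h2t (aemeasurable_deviation (fun i => (hSμ i).aemeasurable) hG)
      (.of_forall fun _ => (deviation_mem_Icc hG hGB _).2)
  have hV : Integrable (fun ω => Real.exp (2 * t * (-V) ω)) P :=
    integrable_exp_mul_of_le _ A h2t
      (aemeasurable_deviation (fun j => (hTν j).aemeasurable) hF).neg
      (.of_forall fun _ => neg_le.2 (deviation_mem_Icc hF hFA _).1)
  have hmgfU : mgf U P (2 * t) ≤ Real.exp ((2 * t) ^ 2 * u) :=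
    mgf_deviation_le hS hSμ hG hGB (by rwa [abs_of_nonneg h2t])
  have hmgfV : mgf (-V) P (2 * t) ≤ Real.exp ((2 * t) ^ 2 * v) := by
    rw [mgf_neg, ← neg_sq]
    exact mgf_deviation_le hT hTν hF hFA (by rwa [abs_neg, abs_of_nonneg h2t])
  have hsq := mul_nonneg (sq_nonneg t) hu
  have hsq' := mul_nonneg (sq_nonneg t) hv
  have hexpU : Real.exp ((2 * t) ^ 2 * u) ≤ Real.exp (t ^ 2 * (4 * (u + v))) :=
    Real.exp_le_exp.2 (by linarith)
  have hexpV : Real.exp ((2 * t) ^ 2 * v) ≤ Real.exp (t ^ 2 * (4 * (u + v))) :=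
    Real.exp_le_exp.2 (by linarith)
  calc mgf (fun ω => U ω - V ω) P t = mgf (U + -V) P t := by rw [← sub_eq_add_neg]; rfl
    _ ≤ (mgf U P (2 * t) + mgf (-V) P (2 * t)) / 2 := mgf_add_le hU hV
    _ ≤ Real.exp (t ^ 2 * (4 * (u + v))) := by linarith

theorem measure_deviation_sub_deviation_ge_le {A B : ℝ} (hA : 0 < A) (hB : 0 < B)
    (hGB : ∀ x, G x ∈ Set.Icc 0 B) (hFA : ∀ y, F y ∈ Set.Icc 0 A) {L : ℝ} (hL : 0 < L) :
    P.real {ω | 2 * (B / n + A / m) * L +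
          4 * √((B * (∫ x, G x ∂μ) / n + A * (∫ y, F y ∂ν) / m) * L) ≤
        deviation μ G (fun i => S i ω) - deviation ν F fun j => T j ω} ≤ Real.exp (-L) := by
  have hn : (0 : ℝ) < n := Nat.cast_pos.2 (NeZero.pos n)
  have hm : (0 : ℝ) < m := Nat.cast_pos.2 (NeZero.pos m)
  have hμG := (integral_mem_Icc (ρ := μ) hG hGB).1
  have hνF := (integral_mem_Icc (ρ := ν) hF hFA).1
  set V := B * (∫ x, G x ∂μ) / n + A * (∫ y, F y ∂ν) / m
  have hsqrt : √(4 * V * L) = 2 * √(V * L) := by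
    rw [show 4 * V * L = 2 ^ 2 * (V * L) by ring, Real.sqrt_mul (by positivity),
      Real.sqrt_sq zero_le_two]
  rw [show 4 * √(V * L) = 2 * √(4 * V * L) by linarith]
  refine measure_ge_le_exp_neg_of_mgf_le (by positivity) (by positivity) hL (fun t ht => ?_)
    fun t ht htb => mgf_deviation_sub_deviation_le hS hSμ hT hTν hG hF hGB hFA ht.le ?_ ?_
  · exact integrable_exp_mul_of_le t (B - -A) ht
      ((aemeasurable_deviation (fun i => (hSμ i).aemeasurable) hG).sub
        (aemeasurable_deviation (fun j => (hTν j).aemeasurable) hF))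
      (.of_forall fun _ => sub_le_sub (deviation_mem_Icc hG hGB _).2 (deviation_mem_Icc hF hFA _).1)
  · rw [← div_le_one hn, mul_div_assoc]
    linarith [mul_pos ht (div_pos hA hm)]
  · rw [← div_le_one hm, mul_div_assoc]
    linarith [mul_pos ht (div_pos hB hn)]

theorem measure_deviation_sub_deviation_ge_le_of_integral_le {B : ℝ} (hB : 1 ≤ B)
    (hGB : ∀ x, G x ∈ Set.Icc 0 B) (hF1 : ∀ y, F y ∈ Set.Icc 0 1) {ρ : ℝ}
    (hGρ : ∫ x, G x ∂μ ≤ B * ρ) (hFρ : ∫ y, F y ∂ν ≤ 4 * B * ρ) {L : ℝ} (hL : 0 < L) :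
    P.real {ω | 2 * B * (L / n + L / m) + 8 * B * (√(ρ * L / n) + √(ρ * L / m)) ≤
        deviation μ G (fun i => S i ω) - deviation ν F fun j => T j ω} ≤ Real.exp (-L) := by
  have hn : (0 : ℝ) < n := Nat.cast_pos.2 (NeZero.pos n)
  have hm : (0 : ℝ) < m := Nat.cast_pos.2 (NeZero.pos m)
  have hρ : 0 ≤ ρ :=
    nonneg_of_mul_nonneg_right ((integral_mem_Icc (ρ := μ) hG hGB).1.trans hGρ) (by positivity)
  have hlin : 2 * (B / n + 1 / m) * L ≤ 2 * B * (L / n + L / m) := by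
    have hLm : L / m ≤ B * (L / m) := le_mul_of_one_le_left (by positivity) hB
    linear_combination 2 * hLm
  have hvar : (B * (∫ x, G x ∂μ) / n + 1 * (∫ y, F y ∂ν) / m) * L ≤
      (2 * B) ^ 2 * (ρ * L / n + ρ * L / m) :=
    calc (B * (∫ x, G x ∂μ) / n + 1 * (∫ y, F y ∂ν) / m) * L
        ≤ (B * (B * ρ) / n + B * (4 * B * ρ) / m) * L := by
          have := (integral_mem_Icc (ρ := ν) hF hF1).1
          gcongr
      _ ≤ (2 * B) ^ 2 * (ρ * L / n + ρ * L / m) := by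
        have : 0 ≤ B ^ 2 * (ρ * L / n) := by positivity
        linear_combination 3 * this
  have hsqrt : √((B * (∫ x, G x ∂μ) / n + 1 * (∫ y, F y ∂ν) / m) * L) ≤
      2 * B * (√(ρ * L / n) + √(ρ * L / m)) :=
    calc √((B * (∫ x, G x ∂μ) / n + 1 * (∫ y, F y ∂ν) / m) * L)
        ≤ √((2 * B) ^ 2 * (ρ * L / n + ρ * L / m)) := Real.sqrt_le_sqrt hvar
      _ = 2 * B * √(ρ * L / n + ρ * L / m) := by
        rw [Real.sqrt_mul (by positivity), Real.sqrt_sq (by positivity)]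
      _ ≤ 2 * B * (√(ρ * L / n) + √(ρ * L / m)) := by
        gcongr
        exact sqrt_add_le_add_sqrt (by positivity) (by positivity)
  have hthreshold : 2 * (B / n + 1 / m) * L +
      4 * √((B * (∫ x, G x ∂μ) / n + 1 * (∫ y, F y ∂ν) / m) * L) ≤
      2 * B * (L / n + L / m) + 8 * B * (√(ρ * L / n) + √(ρ * L / m)) := by linarith
  exact (measureReal_mono fun ω hω => hthreshold.trans hω).trans
    (measure_deviation_sub_deviation_ge_le hS hSμ hT hTν hG hF one_pos
      (zero_lt_one.trans_le hB) hGB hF1 hL)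

end TwoSamples

theorem measure_integral_ge_le [IsProbabilityMeasure P] {μ ν : Measure α}
    [IsProbabilityMeasure μ] [IsProbabilityMeasure ν] {n m : ℕ} [NeZero n] [NeZero m]
    {S : Fin n → Ω → α} (hS : iIndepFun S P) (hSμ : ∀ i, HasLaw (S i) μ P)
    {T : Fin m → Ω → α} (hT : iIndepFun T P) (hTν : ∀ j, HasLaw (T j) ν P)
    {f : α → ℝ} (hf : Measurable f) (hf1 : ∀ x, f x ∈ Set.Icc 0 1) {B : ℝ} (hB : 1 ≤ B)
    (hμν : 4 * B * ∫ x, f x ∂μ ≤ ∫ x, f x ∂ν) {L : ℝ} (hL : 0 < L) :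
    P.real {ω | 4 * (∫ x, f x ∂empirical (fun j => T j ω) -
          B * ∫ x, f x ∂empirical (fun i => S i ω)) + 40 * B * (L / n + L / m) ≤
        ∫ x, f x ∂ν} ≤ Real.exp (-L) := by
  have hn : (0 : ℝ) < n := Nat.cast_pos.2 (NeZero.pos n)
  have hm : (0 : ℝ) < m := Nat.cast_pos.2 (NeZero.pos m)
  have hB0 : 0 < B := zero_lt_one.trans_le hB
  set q := ∫ x, f x ∂ν
  have hq : 0 ≤ q := (integral_mem_Icc hf hf1).1
  set N := L / n + L / m
  have hLm : L / m ≤ B * (L / m) := le_mul_of_one_le_left (by positivity) hB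
  have hvar : (B * (B * ∫ x, f x ∂μ) / n + 1 * q / m) * L ≤ q * (B * N) :=
    calc (B * (B * ∫ x, f x ∂μ) / n + 1 * q / m) * L
        = B * (L / n) * (4 * B * ∫ x, f x ∂μ) / 4 + q * (L / m) := by ring
      _ ≤ B * (L / n) * q + q * (B * (L / m)) := by
        have hfirst := mul_le_mul_of_nonneg_left hμν (by positivity : 0 ≤ B * (L / n))
        have hsecond := mul_le_mul_of_nonneg_left hLm hq
        have hnonneg : 0 ≤ B * (L / n) * q := by positivity
        linarith
      _ = q * (B * N) := by ring
  have hsqrt : 4 * √((B * (B * ∫ x, f x ∂μ) / n + 1 * q / m) * L) ≤ q / 2 + 8 * (B * N) := by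
    have hle : √((B * (B * ∫ x, f x ∂μ) / n + 1 * q / m) * L) ≤ q / 8 + 2 * (B * N) :=
      Real.sqrt_le_iff.2 ⟨by positivity, hvar.trans <| by
        linear_combination four_mul_le_sq_add (q / 8) (2 * (B * N))⟩
    linear_combination 4 * hle
  have hBf : ∀ x, B * f x ∈ Set.Icc 0 B := fun x =>
    ⟨mul_nonneg hB0.le (hf1 x).1, mul_le_of_le_one_right hB0.le (hf1 x).2⟩
  have hconc := measure_deviation_sub_deviation_ge_le hS hSμ hT hTν (hf.const_mul B) hf one_pos
    hB0 hBf hf1 hL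
  refine (measureReal_mono fun ω (hω : _ ≤ q) => ?_).trans hconc
  simp only [deviation, integral_const_mul, Set.mem_ofPred_eq]
  linear_combination (1 / 4) * hω + hsqrt + (1 / 4) * hμν + 2 * hLm

end Concentration

section Discrepancy

variable {𝒳 𝒴 : Type*} [MeasurableSpace 𝒳]

theorem shiftInf_chiSq {Q : Measure 𝒳} [IsProbabilityMeasure Q] {g : 𝒳 → ℝ} (hg : MemLp g 2 Q) :
    shiftInf chiSq Q g = ∫ x, g x ∂Q + Var[g; Q] / 4 := by
  have hg₁ : Integrable g Q := hg.integrable one_le_two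
  have hobj : ∀ α : ℝ, (∫ x, convexConj chiSq (g x + α) ∂Q) - α =
      ∫ x, g x ∂Q + (Var[g; Q] + (∫ x, g x ∂Q + α) ^ 2) / 4 := fun α => by
    have hgα : MemLp (fun x => g x + α) 2 Q := hg.add (memLp_const α)
    have hmean : ∫ x, (g x + α) ∂Q = ∫ x, g x ∂Q + α := by
      rw [integral_add hg₁ (integrable_const α), integral_const, probReal_univ, one_smul]
    have hvar := variance_eq_sub hgα
    rw [variance_add_const hg₁.aestronglyMeasurable, hmean] at hvar
    simp only [convexConj_chiSq]
    rw [integral_add (hgα.integrable_sq.div_const 4) (hgα.integrable one_le_two), integral_div,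
      hmean, hvar]
    simp only [Pi.pow_apply]
    ring
  have hle : ∀ α : ℝ, ∫ x, g x ∂Q + Var[g; Q] / 4 ≤
      (∫ x, convexConj chiSq (g x + α) ∂Q) - α := fun α => by
    rw [hobj]
    gcongr
    exact le_add_of_nonneg_right (sq_nonneg _)
  refine le_antisymm (ciInf_le_of_le ⟨_, Set.forall_mem_range.2 hle⟩ (-∫ x, g x ∂Q) ?_)
    (le_ciInf hle)
  rw [hobj, add_neg_cancel, zero_pow two_ne_zero, add_zero]

theorem le_localDD_chiSq {ℓ : 𝒴 → 𝒴 → ℝ} {H : Set (𝒳 → 𝒴)} {h h' : 𝒳 → 𝒴} (hh' : h' ∈ H)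
    {P Q : Measure 𝒳} [IsProbabilityMeasure Q] (hQ : MemLp (disagree ℓ h h') 2 Q)
    {t : ℝ} (ht : 0 ≤ t) :
    ((t * (∫ x, disagree ℓ h h' x ∂P - ∫ x, disagree ℓ h h' x ∂Q -
      t / 4 * Var[disagree ℓ h h'; Q]) : ℝ) : EReal) ≤ localDD chiSq ℓ H h P Q := by
  refine le_trans (EReal.coe_le_coe_iff.2 (le_of_eq ?_))
    (le_iSup₂_of_le h' hh' (le_iSup₂ (f := fun (t : ℝ) (_ : t ∈ Set.Ici (0 : ℝ)) =>
      (((∫ x, t * disagree ℓ h h' x ∂P) -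
        shiftInf chiSq Q (fun x => t * disagree ℓ h h' x) : ℝ) : EReal)) t ht))
  rw [shiftInf_chiSq (hQ.const_mul t), integral_const_mul, integral_const_mul, variance_const_mul]
  ring

theorem le_localDD_chiSq_div {ℓ : 𝒴 → 𝒴 → ℝ} {H : Set (𝒳 → 𝒴)} {h h' : 𝒳 → 𝒴} (hh' : h' ∈ H)
    {P Q : Measure 𝒳} [IsProbabilityMeasure Q] (hQ : MemLp (disagree ℓ h h') 2 Q)
    {C s : ℝ} (hC : 0 < C) (hs : 0 ≤ s) :
    ((s * (∫ x, disagree ℓ h h' x ∂P - ∫ x, disagree ℓ h h' x ∂Q -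
      s * C / 4 * Var[disagree ℓ h h'; Q]) : ℝ) : EReal) ≤ localDD chiSq ℓ H h P Q / C := by
  refine le_trans (le_of_eq ?_) (EReal.div_le_div_right_of_nonneg (EReal.coe_nonneg.2 hC.le)
    (le_localDD_chiSq hh' hQ (mul_nonneg hs hC.le)))
  rw [← EReal.coe_div, mul_assoc s C, mul_left_comm s C, mul_div_cancel_left₀ _ hC.ne']

theorem variance_le_integral_sub_sq {Q : Measure 𝒳} [IsProbabilityMeasure Q] {f : 𝒳 → ℝ}
    (hf : AEStronglyMeasurable f Q) (c : ℝ) : Var[f; Q] ≤ ∫ x, (f x - c) ^ 2 ∂Q := by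
  rw [← variance_sub_const hf c]
  exact variance_le_expectation_sq (hf.sub aestronglyMeasurable_const)

theorem variance_le_integral {Q : Measure 𝒳} [IsProbabilityMeasure Q] {f : 𝒳 → ℝ}
    (hf : AEMeasurable f Q) (h01 : ∀ x, f x ∈ Set.Icc 0 1) : Var[f; Q] ≤ ∫ x, f x ∂Q := by
  have hbhatiaDavis := variance_le_sub_mul_sub (.of_forall h01) hf
  linarith [sq_nonneg (∫ x, f x ∂Q)]

end Discrepancy

theorem coe_le_coe_add_add_coe {x s d e : ℝ} {D : EReal} (hd : (d : EReal) ≤ D)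
    (hx : x ≤ s + d + e) : (x : EReal) ≤ s + D + e :=
  calc (x : EReal) ≤ ((s + d + e : ℝ) : EReal) := EReal.coe_le_coe_iff.2 hx
    _ = s + d + e := by rw [EReal.coe_add, EReal.coe_add]
    _ ≤ s + D + e := by gcongr

section Loss

/-- The loss of `h'` plus a penalty for the squared distance of `ℓ(h, h')` from the constant `c`.
Its mean is `R(h') + C / 4 * Var(ℓ(h, h'))` when `c` is the mean of `ℓ(h, h')`, and at least that
for every other `c`, so that concentration for this one function of `(x, y)` handles the risk and
the variance together. -/
noncomputable def penalizedLoss {𝒳 𝒴 : Type*} (ℓ : 𝒴 → 𝒴 → ℝ) (C : ℝ) (h h' : 𝒳 → 𝒴) (c : ℝ)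
    (z : 𝒳 × 𝒴) : ℝ :=
  ℓ (h' z.1) z.2 + C / 4 * (disagree ℓ h h' z.1 - c) ^ 2

theorem penalizedLoss_mem_Icc {𝒳 𝒴 : Type*} {ℓ : 𝒴 → 𝒴 → ℝ}
    (hℓ1 : ∀ y y', ℓ y y' ∈ Set.Icc (0 : ℝ) 1) {h h' : 𝒳 → 𝒴} {C : ℝ} (hC : 0 ≤ C)
    {c : ℝ} (hc : c ∈ Set.Icc 0 1) (z : 𝒳 × 𝒴) :
    penalizedLoss ℓ C h h' c z ∈ Set.Icc 0 (1 + C) := by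
  have hsq : (disagree ℓ h h' z.1 - c) ^ 2 ≤ 1 := (sq_le_one_iff_abs_le_one _).2 <|
    (abs_sub_le_of_le_of_le (hℓ1 _ _).1 (hℓ1 _ _).2 hc.1 hc.2).trans_eq (sub_zero 1)
  have hloss := hℓ1 (h' z.1) z.2
  have hpen : C * (disagree ℓ h h' z.1 - c) ^ 2 ≤ C := mul_le_of_le_one_right hC hsq
  have hpen0 : 0 ≤ C * (disagree ℓ h h' z.1 - c) ^ 2 := by positivity
  exact ⟨by rw [penalizedLoss]; linarith [hloss.1], by rw [penalizedLoss]; linarith [hloss.2]⟩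

variable {𝒳 𝒴 : Type*} [MeasurableSpace 𝒳] [MeasurableSpace 𝒴] {ℓ : 𝒴 → 𝒴 → ℝ}
  (hℓ : Measurable (Function.uncurry ℓ)) (hℓ1 : ∀ y y', ℓ y y' ∈ Set.Icc (0 : ℝ) 1)
  {h h' : 𝒳 → 𝒴} (hh : Measurable h) (hh' : Measurable h')
  {μ : Measure (𝒳 × 𝒴)} [IsFiniteMeasure μ]

include hℓ

include hh in
theorem measurable_loss : Measurable fun z : 𝒳 × 𝒴 => ℓ (h z.1) z.2 :=
  hℓ.comp ((hh.comp measurable_fst).prodMk measurable_snd)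

include hh hh'

theorem measurable_disagree : Measurable (disagree ℓ h h') :=
  hℓ.comp (hh.prodMk hh')

theorem measurable_penalizedLoss (C c : ℝ) : Measurable (penalizedLoss ℓ C h h' c) :=
  (measurable_loss hℓ hh').add
    ((((measurable_disagree hℓ hh hh').comp measurable_fst).sub_const c).pow_const 2 |>.const_mul _)

include hℓ1

omit hh' in
theorem integrable_loss : Integrable (fun z : 𝒳 × 𝒴 => ℓ (h z.1) z.2) μ :=
  .of_mem_Icc 0 1 (measurable_loss hℓ hh).aemeasurable (.of_forall fun _ => hℓ1 _ _)

theorem memLp_disagree {Q : Measure 𝒳} [IsFiniteMeasure Q] (p : ℝ≥0∞) :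
    MemLp (disagree ℓ h h') p Q :=
  memLp_of_bounded (.of_forall fun _ => hℓ1 _ _)
    (measurable_disagree hℓ hh hh').aestronglyMeasurable p

omit hℓ1 [IsFiniteMeasure μ] in
theorem integral_disagree_fst :
    ∫ x, disagree ℓ h h' x ∂μ.fst = ∫ z, ℓ (h z.1) (h' z.1) ∂μ :=
  integral_map measurable_fst.aemeasurable (measurable_disagree hℓ hh hh').aestronglyMeasurable

theorem integrable_disagree_fst : Integrable (fun z : 𝒳 × 𝒴 => ℓ (h z.1) (h' z.1)) μ :=
  ((memLp_disagree hℓ hℓ1 hh hh' (Q := μ.fst) 1).integrable le_rfl).comp_measurable measurable_fst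

theorem integral_penalizedLoss (C c : ℝ) :
    ∫ z, penalizedLoss ℓ C h h' c z ∂μ =
      risk ℓ μ h' + C / 4 * ∫ x, (disagree ℓ h h' x - c) ^ 2 ∂μ.fst := by
  have hsq : Integrable (fun x => (disagree ℓ h h' x - c) ^ 2) μ.fst :=
    ((memLp_disagree hℓ hℓ1 hh hh' 2).sub (memLp_const c)).integrable_sq
  rw [Measure.fst] at hsq ⊢
  rw [integral_map measurable_fst.aemeasurable hsq.aestronglyMeasurable, ← integral_const_mul]
  exact integral_add (integrable_loss hℓ hℓ1 hh')
    ((hsq.comp_measurable measurable_fst).const_mul (C / 4))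

theorem risk_le_integral_disagree_add_risk
    (htri : ∀ y₁ y₂ y₃, ℓ y₁ y₂ ≤ ℓ y₁ y₃ + ℓ y₃ y₂) :
    risk ℓ μ h ≤ ∫ x, disagree ℓ h h' x ∂μ.fst + risk ℓ μ h' := by
  rw [integral_disagree_fst hℓ hh hh', risk, risk, ← integral_add
    (integrable_disagree_fst hℓ hℓ1 hh hh') (integrable_loss hℓ hℓ1 hh')]
  exact integral_mono (integrable_loss hℓ hℓ1 hh)
    ((integrable_disagree_fst hℓ hℓ1 hh hh').add (integrable_loss hℓ hℓ1 hh'))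
    fun z => htri _ _ _

theorem integral_disagree_le_risk_add_risk (hsymm : ∀ y y', ℓ y y' = ℓ y' y)
    (htri : ∀ y₁ y₂ y₃, ℓ y₁ y₂ ≤ ℓ y₁ y₃ + ℓ y₃ y₂) :
    ∫ x, disagree ℓ h h' x ∂μ.fst ≤ risk ℓ μ h + risk ℓ μ h' := by
  rw [integral_disagree_fst hℓ hh hh', risk, risk, ← integral_add
    (integrable_loss hℓ hℓ1 hh) (integrable_loss hℓ hℓ1 hh')]
  exact integral_mono (integrable_disagree_fst hℓ hℓ1 hh hh')
    ((integrable_loss hℓ hℓ1 hh).add (integrable_loss hℓ hℓ1 hh'))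
    fun z => (htri _ _ z.2).trans_eq (by rw [hsymm z.2])

variable {H : Set (𝒳 → 𝒴)} {C : ℝ} (hC : 0 < C) {ν : Measure (𝒳 × 𝒴)} [IsFiniteMeasure ν]
  {ρ : Measure (𝒳 × 𝒴)} [IsProbabilityMeasure ρ] {Q : Measure 𝒳}
  (hh'H : h' ∈ H)
include hC hh'H

omit [IsFiniteMeasure μ] in
theorem risk_le_of_penalizedLoss_deviation_le (hsymm : ∀ y y', ℓ y y' = ℓ y' y)
    (htri : ∀ y₁ y₂ y₃, ℓ y₁ y₂ ≤ ℓ y₁ y₃ + ℓ y₃ y₂) {c θ : ℝ}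
    (hθ : (∫ z, penalizedLoss ℓ C h h' c z ∂ρ - ∫ z, penalizedLoss ℓ C h h' c z ∂μ) -
      (∫ x, disagree ℓ h h' x ∂Q - ∫ x, disagree ℓ h h' x ∂ν.fst) ≤ θ) :
    (risk ℓ ν h : EReal) ≤ risk ℓ ρ h + localDD chiSq ℓ H h Q ρ.fst / C +
      ((∫ z, penalizedLoss ℓ C h h' c z ∂μ + risk ℓ ν h' + θ : ℝ) : EReal) := by
  have hρ := memLp_disagree hℓ hℓ1 hh hh' (Q := ρ.fst) 2
  refine coe_le_coe_add_add_coe (le_localDD_chiSq_div hh'H hρ hC zero_le_one) ?_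
  have hpen := integral_penalizedLoss hℓ hℓ1 hh hh' (μ := ρ) C c
  have hvar := mul_le_mul_of_nonneg_left
    (variance_le_integral_sub_sq hρ.aestronglyMeasurable c) (by positivity : 0 ≤ C / 4)
  have hν := risk_le_integral_disagree_add_risk hℓ hℓ1 hh hh' (μ := ν) htri
  have hρ' := integral_disagree_le_risk_add_risk hℓ hℓ1 hh hh' (μ := ρ) hsymm htri
  linear_combination hν + hρ' + hvar - hpen + hθ

theorem risk_le_of_integral_disagree_le (htri : ∀ y₁ y₂ y₃, ℓ y₁ y₂ ≤ ℓ y₁ y₃ + ℓ y₃ y₂) {θ : ℝ}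
    (hθ : ∫ x, disagree ℓ h h' x ∂ν.fst ≤
      4 * (∫ x, disagree ℓ h h' x ∂Q - (1 + C) * ∫ x, disagree ℓ h h' x ∂ρ.fst) + θ) :
    (risk ℓ ν h : EReal) ≤ risk ℓ ρ h + localDD chiSq ℓ H h Q ρ.fst / C +
      ((risk ℓ ν h' + θ : ℝ) : EReal) := by
  have hρ := memLp_disagree hℓ hℓ1 hh hh' (Q := ρ.fst) 2
  refine coe_le_coe_add_add_coe (le_localDD_chiSq_div hh'H hρ hC zero_le_four) ?_
  have hvar := mul_le_mul_of_nonneg_left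
    (variance_le_integral hρ.aemeasurable fun x => hℓ1 _ _) hC.le
  have hν := risk_le_integral_disagree_add_risk hℓ hℓ1 hh hh' (μ := ν) htri
  have hρ0 : 0 ≤ risk ℓ ρ h := integral_nonneg fun _ => (hℓ1 _ _).1
  linear_combination hν + 4 * hvar + hρ0 + hθ

end Loss

section Oracle

variable {𝒳 𝒴 Ω : Type*} [MeasurableSpace 𝒳] [MeasurableSpace 𝒴] [MeasurableSpace Ω]

/-- The bound `R_μ̂(h) + D(ν̂‖μ̂) / C + e` on the target risk of `h`, for a labelled source sample
`x`, an unlabelled target sample `y` and a deterministic remainder `e`. -/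
noncomputable def empiricalRiskBound (ℓ : 𝒴 → 𝒴 → ℝ) (H : Set (𝒳 → 𝒴)) (h : 𝒳 → 𝒴) (C : ℝ)
    {n m : ℕ} (x : Fin n → 𝒳 × 𝒴) (y : Fin m → 𝒳) (e : ℝ) : EReal :=
  risk ℓ (empirical x) h +
    localDD chiSq ℓ H h (empirical y) (empirical fun i => (x i).1) / C + e

theorem empiricalRiskBound_mono (ℓ : 𝒴 → 𝒴 → ℝ) (H : Set (𝒳 → 𝒴)) (h : 𝒳 → 𝒴) (C : ℝ)
    {n m : ℕ} (x : Fin n → 𝒳 × 𝒴) (y : Fin m → 𝒳) :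
    Monotone (empiricalRiskBound ℓ H h C x y) := fun _ _ he =>
  add_le_add_right (EReal.coe_le_coe_iff.2 he) _

variable {P : Measure Ω} [IsProbabilityMeasure P] {μ ν : Measure (𝒳 × 𝒴)}
  [IsProbabilityMeasure μ] [IsProbabilityMeasure ν] {ℓ : 𝒴 → 𝒴 → ℝ}
  (hℓ : Measurable (Function.uncurry ℓ)) (hℓ1 : ∀ y y', ℓ y y' ∈ Set.Icc (0 : ℝ) 1)
  (htri : ∀ y₁ y₂ y₃, ℓ y₁ y₂ ≤ ℓ y₁ y₃ + ℓ y₃ y₂)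
  {H : Set (𝒳 → 𝒴)} {h h' : 𝒳 → 𝒴} (hh : Measurable h) (hh' : Measurable h') (hh'H : h' ∈ H)
  {C : ℝ} (hC : 0 < C) {n m : ℕ} [NeZero n] [NeZero m]
  {S : Fin n → Ω → 𝒳 × 𝒴} (hS : iIndepFun S P) (hSμ : ∀ i, HasLaw (S i) μ P)
  {T : Fin m → Ω → 𝒳} (hT : iIndepFun T P) (hTν : ∀ j, HasLaw (T j) ν.fst P)
include hℓ hℓ1 htri hh hh' hh'H hC hS hSμ hT hTν

theorem measure_empiricalRiskBound_lt_le_of_integral_le (hsymm : ∀ y y', ℓ y y' = ℓ y' y) {s L : ℝ}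
    (hs : risk ℓ μ h + risk ℓ μ h' ≤ s)
    (hνs : ∫ x, disagree ℓ h h' x ∂ν.fst ≤ 4 * (1 + C) * s) (hL : 0 < L) :
    P.real {ω | empiricalRiskBound ℓ H h C (fun i => S i ω) (fun j => T j ω)
        (risk ℓ μ h' + C / 4 * Var[disagree ℓ h h'; μ.fst] + risk ℓ ν h' +
          (2 * (1 + C) * (L / n + L / m) + 8 * (1 + C) * (√(s * L / n) + √(s * L / m)))) <
      risk ℓ ν h} ≤ Real.exp (-L) := by
  have hf := measurable_disagree hℓ hh hh'
  set c := ∫ x, disagree ℓ h h' x ∂μ.fst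
  have hc : c ∈ Set.Icc 0 1 := integral_mem_Icc hf fun _ => hℓ1 _ _
  have hmean : ∫ z, penalizedLoss ℓ C h h' c z ∂μ =
      risk ℓ μ h' + C / 4 * Var[disagree ℓ h h'; μ.fst] := by
    rw [integral_penalizedLoss hℓ hℓ1 hh hh', variance_eq_integral hf.aemeasurable]
  have hmean_le : ∫ z, penalizedLoss ℓ C h h' c z ∂μ ≤ (1 + C) * s := by
    have hvar : Var[disagree ℓ h h'; μ.fst] ≤ c :=
      variance_le_integral hf.aemeasurable fun _ => hℓ1 _ _
    have hcs : c ≤ s := (integral_disagree_le_risk_add_risk hℓ hℓ1 hh hh' hsymm htri).trans hs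
    have hh0 : 0 ≤ risk ℓ μ h := integral_nonneg fun _ => (hℓ1 _ _).1
    rw [hmean]
    nlinarith [hvar.trans hcs, hc.1.trans hcs]
  refine (measureReal_mono fun ω hω => ?_).trans
    (measure_deviation_sub_deviation_ge_le_of_integral_le hS hSμ hT hTν
      (measurable_penalizedLoss hℓ hh hh' C c) hf (le_add_of_nonneg_right hC.le)
      (penalizedLoss_mem_Icc hℓ1 hC.le hc) (fun _ => hℓ1 _ _) hmean_le hνs hL)
  contrapose! hω
  have hrisk := risk_le_of_penalizedLoss_deviation_le hℓ hℓ1 hh hh' hC hh'H hsymm htri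
    (not_le.1 hω).le
  rwa [hmean, Measure.fst, map_empirical _ measurable_fst, ← not_lt] at hrisk

theorem measure_empiricalRiskBound_lt_le_of_le_integral {L : ℝ}
    (hμν : 4 * (1 + C) * ∫ x, disagree ℓ h h' x ∂μ.fst ≤ ∫ x, disagree ℓ h h' x ∂ν.fst)
    (hL : 0 < L) :
    P.real {ω | empiricalRiskBound ℓ H h C (fun i => S i ω) (fun j => T j ω)
        (risk ℓ ν h' + 40 * (1 + C) * (L / n + L / m)) < risk ℓ ν h} ≤ Real.exp (-L) := by
  have hS₁ : iIndepFun (fun i ω => (S i ω).1) P :=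
    hS.comp (fun _ => Prod.fst) fun _ => measurable_fst
  have hS₁μ : ∀ i, HasLaw (fun ω => (S i ω).1) μ.fst P := fun i =>
    (⟨measurable_fst.aemeasurable, rfl⟩ : HasLaw Prod.fst μ.fst μ).comp (hSμ i)
  refine (measureReal_mono fun ω hω => ?_).trans
    (measure_integral_ge_le hS₁ hS₁μ hT hTν (measurable_disagree hℓ hh hh') (fun _ => hℓ1 _ _)
      (le_add_of_nonneg_right hC.le) hμν hL)
  contrapose! hω
  have hfst : (empirical fun i => S i ω).fst = empirical fun i => (S i ω).1 :=
    map_empirical _ measurable_fst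
  have hrisk := risk_le_of_integral_disagree_le hℓ hℓ1 hh hh' hC hh'H htri
    (ρ := empirical fun i => S i ω) (ν := ν) (by rw [hfst]; exact (not_le.1 hω).le)
  rwa [hfst, ← not_lt] at hrisk

theorem measure_empiricalRiskBound_lt_le (hsymm : ∀ y y', ℓ y y' = ℓ y' y) {s L : ℝ}
    (hs : risk ℓ μ h + risk ℓ μ h' ≤ s) (hL : 0 < L) :
    P.real {ω | empiricalRiskBound ℓ H h C (fun i => S i ω) (fun j => T j ω)
        (risk ℓ μ h' + C / 4 * Var[disagree ℓ h h'; μ.fst] + risk ℓ ν h' +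
          (40 * (1 + C) * (L / n + L / m) + 8 * (1 + C) * (√(s * L / n) + √(s * L / m)))) <
      risk ℓ ν h} ≤ Real.exp (-L) := by
  rcases le_total (∫ x, disagree ℓ h h' x ∂ν.fst) (4 * (1 + C) * s) with hνs | hνs
  · refine (measureReal_mono fun ω hω => (empiricalRiskBound_mono _ _ _ _ _ _ ?_).trans_lt hω).trans
      (measure_empiricalRiskBound_lt_le_of_integral_le hℓ hℓ1 htri hh hh' hh'H hC hS hSμ hT hTν
        hsymm hs hνs hL)
    gcongr
    norm_num
  · have hμs : ∫ x, disagree ℓ h h' x ∂μ.fst ≤ s :=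
      (integral_disagree_le_risk_add_risk hℓ hℓ1 hh hh' hsymm htri).trans hs
    have hμν : 4 * (1 + C) * ∫ x, disagree ℓ h h' x ∂μ.fst ≤ ∫ x, disagree ℓ h h' x ∂ν.fst :=
      (mul_le_mul_of_nonneg_left hμs (by positivity)).trans hνs
    refine (measureReal_mono fun ω hω => (empiricalRiskBound_mono _ _ _ _ _ _ ?_).trans_lt hω).trans
      (measure_empiricalRiskBound_lt_le_of_le_integral hℓ hℓ1 htri hh hh' hh'H hC hS hSμ hT hTν
        hμν hL)
    have hrisk : 0 ≤ risk ℓ μ h' := integral_nonneg fun _ => (hℓ1 _ _).1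
    have hvar : 0 ≤ C / 4 * Var[disagree ℓ h h'; μ.fst] :=
      mul_nonneg (by positivity) (variance_nonneg _ _)
    have hsqrt : 0 ≤ 8 * (1 + C) * (√(s * L / n) + √(s * L / m)) := by positivity
    linarith

end Oracle

theorem integral_disagree_le_supDisagree {𝒳 𝒴 : Type*} [MeasurableSpace 𝒳] {ℓ : 𝒴 → 𝒴 → ℝ}
    (hℓ1 : ∀ y y', ℓ y y' ∈ Set.Icc (0 : ℝ) 1) {H : Set (𝒳 → 𝒴)} (h : 𝒳 → 𝒴) {h' : 𝒳 → 𝒴}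
    (hh' : h' ∈ H) (Q : Measure 𝒳) [IsProbabilityMeasure Q] :
    ∫ x, disagree ℓ h h' x ∂Q ≤ supDisagree ℓ H h Q := by
  refine le_ciSup (f := fun g : H => ∫ x, disagree ℓ h g x ∂Q)
    ⟨1, Set.forall_mem_range.2 fun g => ?_⟩ ⟨h', hh'⟩
  have hnorm : ∀ x, ‖disagree ℓ h g x‖ ≤ 1 := fun x =>
    (Real.norm_of_nonneg (hℓ1 _ _).1).trans_le (hℓ1 _ _).2
  calc ∫ x, disagree ℓ h g x ∂Q ≤ ‖∫ x, disagree ℓ h g x ∂Q‖ := Real.le_norm_self _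
    _ ≤ 1 * Q.real Set.univ := norm_integral_le_of_norm_le_const (.of_forall hnorm)
    _ = 1 := by rw [probReal_univ, mul_one]

theorem rademacher_nonneg {α : Type*} {n : ℕ} (x : Fin n → α) {F : Set (α → ℝ)}
    (hF : F.Nonempty) {b : ℝ} (hb : ∀ f ∈ F, ∀ z, |f z| ≤ b) : 0 ≤ rademacher x F := by
  obtain ⟨f, hf⟩ := hF
  let corr : (α → ℝ) → (Fin n → ℤˣ) → ℝ := fun g ε => 1 / n * ∑ i, ((ε i : ℤ) : ℝ) * g (x i)
  have hodd : (corr f).Odd := fun ε => by simp [corr]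
  have hbdd : ∀ ε, ∀ g : F, corr g ε ≤ 1 / n * ∑ _i : Fin n, b := fun ε g => by
    have hterm : ∀ i, ((ε i : ℤ) : ℝ) * (g : α → ℝ) (x i) ≤ b := fun i => by
      rcases Int.units_eq_one_or (ε i) with hi | hi
      · simpa [hi] using (abs_le.1 (hb g g.2 (x i))).2
      · simpa [hi] using neg_le.1 (abs_le.1 (hb g g.2 (x i))).1
    exact mul_le_mul_of_nonneg_left (Finset.sum_le_sum fun i _ => hterm i) (by positivity)
  refine mul_nonneg (by positivity) (hodd.sum_eq_zero.ge.trans (Finset.sum_le_sum fun ε _ => ?_))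
  exact le_ciSup (f := fun g : F => corr g ε) ⟨_, Set.forall_mem_range.2 (hbdd ε)⟩ ⟨f, hf⟩

theorem rademacher_lossClass_nonneg {𝒳 𝒴 : Type*} {n : ℕ} (x : Fin n → 𝒳) {ℓ : 𝒴 → 𝒴 → ℝ}
    (hℓ1 : ∀ y y', ℓ y y' ∈ Set.Icc (0 : ℝ) 1) {H : Set (𝒳 → 𝒴)} (hH : H.Nonempty) :
    0 ≤ rademacher x (lossClass ℓ H) := by
  obtain ⟨h, hh⟩ := hH
  refine rademacher_nonneg x ⟨_, h, hh, h, hh, rfl⟩ (b := 1) ?_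
  rintro _ ⟨g, -, g', -, rfl⟩ z
  exact (abs_of_nonneg (hℓ1 (g z) (g' z)).1).trans_le (hℓ1 _ _).2

theorem rashomon_mono {𝒳 𝒴 : Type*} [MeasurableSpace 𝒳] [MeasurableSpace 𝒴] (ℓ : 𝒴 → 𝒴 → ℝ)
    (μ : Measure (𝒳 × 𝒴)) (H : Set (𝒳 → 𝒴)) : Monotone (rashomon ℓ μ H) :=
  fun _ _ hst _ hh => ⟨hh.1, hh.2.trans hst⟩

end DomainAdaptation

open DomainAdaptation in
theorem theorem7_general {𝒳 𝒴 Ω : Type*} [MeasurableSpace 𝒳] [MeasurableSpace 𝒴]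
    [MeasurableSpace Ω] {P : Measure Ω} [IsProbabilityMeasure P] {μ ν : Measure (𝒳 × 𝒴)}
    [IsProbabilityMeasure μ] [IsProbabilityMeasure ν] {ℓ : 𝒴 → 𝒴 → ℝ}
    (hℓ : Measurable (Function.uncurry ℓ)) (hℓ1 : ∀ y y', ℓ y y' ∈ Set.Icc (0 : ℝ) 1)
    (hsymm : ∀ y y', ℓ y y' = ℓ y' y) (htri : ∀ y₁ y₂ y₃, ℓ y₁ y₂ ≤ ℓ y₁ y₃ + ℓ y₃ y₂)
    {H : Set (𝒳 → 𝒴)} (hH : ∀ h' ∈ H, Measurable h') {r r₁ : ℝ}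
    (hr : (rashomon ℓ μ H r).Nonempty) {h : 𝒳 → 𝒴} (hh : Measurable h) (hr₁ : risk ℓ μ h ≤ r₁)
    {C₁ C₂ : ℝ} (hC₁ : 0 < C₁) (hC₂ : 0 ≤ C₂)
    (hvar : ∀ h' ∈ rashomon ℓ μ H r,
      C₁ * Var[disagree ℓ h h'; μ.fst] / 4 ≤ C₂ * ∫ x, disagree ℓ h h' x ∂μ.fst)
    {n m : ℕ} (hn : 0 < n) (hm : 0 < m)
    {S : Fin n → Ω → 𝒳 × 𝒴} (hS : iIndepFun S P) (hSμ : ∀ i, HasLaw (S i) μ P)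
    {T : Fin m → Ω → 𝒳} (hT : iIndepFun T P) (hTν : ∀ j, HasLaw (T j) ν.fst P)
    {δ : ℝ} (hδ : δ ∈ Set.Ioo (0 : ℝ) 1) :
    P {ω | empiricalRiskBound ℓ (rashomon ℓ μ H r) h C₁ (fun i => S i ω) (fun j => T j ω)
        (C₂ * supDisagree ℓ (rashomon ℓ μ H r) h μ.fst + jointRisk ℓ (rashomon ℓ μ H r) μ ν +
          41 * (1 + C₁) * (Real.log (1 / δ) / n + Real.log (1 / δ) / m) +
          41 * (1 + C₁) *
            (√((r₁ + r) * Real.log (1 / δ) / n) + √((r₁ + r) * Real.log (1 / δ) / m))) <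
      risk ℓ ν h} ≤ ENNReal.ofReal δ := by
  have : NeZero n := ⟨hn.ne'⟩
  have : NeZero m := ⟨hm.ne'⟩
  have hL : 0 < Real.log (1 / δ) := Real.log_pos (one_lt_one_div hδ.1 hδ.2)
  have hδL : Real.exp (-Real.log (1 / δ)) = δ := by
    rw [one_div, Real.log_inv, neg_neg, Real.exp_log hδ.1]
  set L := Real.log (1 / δ)
  have : Nonempty (rashomon ℓ μ H r) := hr.to_subtype
  obtain ⟨⟨h', hh'⟩, hjoint⟩ := exists_lt_of_ciInf_lt
    (lt_add_of_pos_right (jointRisk ℓ (rashomon ℓ μ H r) μ ν) (by positivity : 0 < L / n + L / m))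
  have hsqrt : 0 ≤ (1 + C₁) * (√((r₁ + r) * L / n) + √((r₁ + r) * L / m)) := by positivity
  have hsup := mul_le_mul_of_nonneg_left (integral_disagree_le_supDisagree hℓ1 h hh' μ.fst) hC₂
  have hslack : L / n + L / m ≤ (1 + C₁) * (L / n + L / m) :=
    le_mul_of_one_le_left (by positivity) (le_add_of_nonneg_right hC₁.le)
  have horacle := measure_empiricalRiskBound_lt_le hℓ hℓ1 htri hh (hH h' hh'.1) hh' hC₁ hS hSμ hT
    hTν hsymm (add_le_add hr₁ hh'.2) hL
  refine (ENNReal.le_ofReal_iff_toReal_le (measure_ne_top P _) hδ.1.le).2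
    ((measureReal_mono fun ω hω => ?_).trans (horacle.trans_eq hδL))
  refine (empiricalRiskBound_mono _ _ _ _ _ _ ?_).trans_lt hω
  linarith [hvar h' hh']

theorem theorem7 (C₁ : ℝ) (hC₁ : 0 < C₁) :
    -- one constant, depending on `C₁` only, serves for all the `O(·)` terms
    ∃ K : ℝ, ∀ (𝒳 : Type u) (𝒴 : Type v) (Ω : Type w)
      [MeasurableSpace 𝒳] [MeasurableSpace 𝒴] [MeasurableSpace Ω]
      (P : Measure Ω) [IsProbabilityMeasure P]
      (μ ν : Measure (𝒳 × 𝒴)) [IsProbabilityMeasure μ] [IsProbabilityMeasure ν]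
      (ℓ : 𝒴 → 𝒴 → ℝ) (_ : Measurable (Function.uncurry ℓ))
      (_ : ∀ y y', ℓ y y' ∈ Set.Icc (0 : ℝ) 1)
      (_ : ∀ y y', ℓ y y' = ℓ y' y)
      (_ : ∀ y₁ y₂ y₃, ℓ y₁ y₂ ≤ ℓ y₁ y₃ + ℓ y₃ y₂)
      (H : Set (𝒳 → 𝒴)) (_ : ∀ h ∈ H, Measurable h)
      (r r₁ : ℝ) (_ : (DomainAdaptation.rashomon ℓ μ H r).Nonempty)
      (h : 𝒳 → 𝒴) (_ : h ∈ DomainAdaptation.rashomon ℓ μ H r₁)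
      (C₂ : ℝ) (_ : C₂ ∈ Set.Ioo (0 : ℝ) 1)
      (_ : ∀ h' ∈ DomainAdaptation.rashomon ℓ μ H r,
        C₁ * variance (DomainAdaptation.disagree ℓ h h') μ.fst / 4 ≤
          C₂ * ∫ x, DomainAdaptation.disagree ℓ h h' x ∂μ.fst)
      (n m : ℕ) (_ : 0 < n) (_ : 0 < m)
      -- the labelled source sample and the unlabelled target sample
      (S : Fin n → Ω → 𝒳 × 𝒴) (_ : iIndepFun S P) (_ : ∀ i, HasLaw (S i) μ P)
      (T : Fin m → Ω → 𝒳) (_ : iIndepFun T P) (_ : ∀ j, HasLaw (T j) ν.fst P)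
      (δ : ℝ) (_ : δ ∈ Set.Ioo (0 : ℝ) 1),
      P {ω | ¬ ((DomainAdaptation.risk ℓ ν h : EReal) ≤
          (DomainAdaptation.risk ℓ (DomainAdaptation.empirical (fun i => S i ω)) h : EReal)
          + DomainAdaptation.localDD DomainAdaptation.chiSq ℓ
              (DomainAdaptation.rashomon ℓ μ H r) h
              (DomainAdaptation.empirical (fun j => T j ω))
              (DomainAdaptation.empirical (fun i => (S i ω).1)) / (C₁ : EReal)
          + ((C₂ * DomainAdaptation.supDisagree ℓ (DomainAdaptation.rashomon ℓ μ H r) h μ.fst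
              + DomainAdaptation.jointRisk ℓ (DomainAdaptation.rashomon ℓ μ H r) μ ν
              + K * (DomainAdaptation.rademacher (fun j => T j ω)
                    (DomainAdaptation.lossClass ℓ (DomainAdaptation.rashomon ℓ μ H r))
                  + DomainAdaptation.rademacher (fun i => (S i ω).1)
                    (DomainAdaptation.lossClass ℓ
                      (DomainAdaptation.rashomon ℓ μ H (max r r₁))))
              + K * (Real.log (1 / δ) / n + Real.log (1 / δ) / m)
              + K * (√((r₁ + r) * Real.log (1 / δ) / n)
                  + √((r₁ + r) * Real.log (1 / δ) / m)) : ℝ) : EReal))}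
        ≤ ENNReal.ofReal δ := by
  refine ⟨41 * (1 + C₁), fun 𝒳 𝒴 Ω _ _ _ P _ μ ν _ _ ℓ hℓ hℓ1 hsymm htri H hH r r₁ hr h hh C₂ hC₂
    hvar n m hn hm S hS hSμ T hT hTν δ hδ => (measure_mono fun ω hω => ?_).trans
      (theorem7_general hℓ hℓ1 hsymm htri hH hr (hH h hh.1) hh.2 hC₁ hC₂.1.le hvar hn hm
        hS hSμ hT hTν hδ)⟩
  refine (DomainAdaptation.empiricalRiskBound_mono _ _ _ _ _ _ ?_).trans_lt (not_le.1 hω)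
  have hTrad := DomainAdaptation.rademacher_lossClass_nonneg (fun j => T j ω) hℓ1 hr
  have hSrad := DomainAdaptation.rademacher_lossClass_nonneg (fun i => (S i ω).1) hℓ1
    (hr.mono (DomainAdaptation.rashomon_mono ℓ μ H (le_max_left r r₁)))
  have hrad := mul_nonneg (by positivity : 0 ≤ 41 * (1 + C₁)) (add_nonneg hTrad hSrad)
  linarith
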